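/- Let $(X,d)$ be an unbounded metric space. Give the set of all ultrafilters on $X$ the topology generated by the sets $\{p : A\in p\}$, $A\subseteq X$ (this is the Stone–Čech compactification of $X$ with the discrete topology), and let $X^\sharp$ be the subspace of all ultrafilters that contain $X\setminus B$ for every bounded $B\subseteq X$. For $A\subseteq X$ and $\varepsilon>0$ put $B_\varepsilon(A)=\{x\in X : d(x,A)\le\varepsilon\}$. Call $p,q\in X^\sharp$ *parallel* if for some real $\varepsilon>0$ we have $B_\varepsilon(P)\in q$ for all $P\in p$ and $B_\varepsilon(Q)\in p$ for all $Q\in q$. The *corona* $\check X$ is the quotient space of $X^\sharp$ by the smallest equivalence relation that is closed in $X^\sharp\times X^\sharp$ and contains all pairs of parallel ultrafilters. The *character* of a point of a topological space is the smallest cardinality of a neighborhood base at that point, and the *minimal character* $\mathsf m\chi(T)$ of a nonempty topological space $T$ is the smallest character of a point of $T$. Let $\mathfrak u=\mathsf m\chi(\omega^*)$, where $\omega^*=\beta\omega\setminus\omega$ is the space of nonprincipal ultrafilters on $\omega$, and let $\mathfrak d$ be the dominating number, i.e. the cofinality of the set $\omega^\omega$ ordered pointwise. Say that $X$ *has asymptotically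 isolated balls* if there is a real $\varepsilon\ge 0$ such that for every real $\delta\ge\varepsilon$ there is a point $x\in X$ with $\{y : d(x,y)\le\varepsilon\}=\{y : d(x,y)\le\delta\}$. **Theorem.** $$\mathsf m\chi(\check X)=\begin{cases}\mathfrak u & \text{if } X \text{ has asymptotically isolated balls},\\ \max\{\mathfrak u,\mathfrak d\} & \text{otherwise.}\end{cases}$$ -/

import Mathlib

open Filter Topology

universe u

/-- The character of a point `x` of a topological space `T`: the smallest cardinality of a
neighborhood base at `x`. -/
noncomputable def pointCharacter {T : Type u} [TopologicalSpace T] (x : T) : Cardinal.{u} :=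
  sInf {κ : Cardinal.{u} | ∃ B : Set (Set T),
    (𝓝 x).HasBasis (fun U : Set T => U ∈ B) id ∧ Cardinal.mk B = κ}

/-- The minimal character of a topological space `T`: the smallest character of a point of `T`
(a genuine minimum whenever `T` is nonempty). -/
noncomputable def minCharacter (T : Type u) [TopologicalSpace T] : Cardinal.{u} :=
  sInf (Set.range fun x : T => pointCharacter x)

/-- The set of ultrafilters on `X` that extend the filter of cobounded subsets of `X`. -/
def sharpSet (X : Type u) [MetricSpace X] : Set (Ultrafilter X) :=
  {p | ∀ B : Set X, Bornology.IsBounded B → Bᶜ ∈ p}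

/-- The space `X♯`, with the topology inherited from the space `Ultrafilter X`, the
Stone–Čech compactification of the discrete space `X`. -/
abbrev Sharp (X : Type u) [MetricSpace X] : Type u := sharpSet X

/-- Two ultrafilters in `X♯` are parallel if, for some `ε > 0`, each of them contains the closed
`ε`-neighborhoods `{x | d(x, A) ≤ ε}` of all members `A` of the other. -/
def Parallel {X : Type u} [MetricSpace X] (p q : Sharp X) : Prop :=
  ∃ ε : ℝ, 0 < ε ∧
    (∀ P ∈ (p : Ultrafilter X), Metric.cthickening ε P ∈ (q : Ultrafilter X)) ∧
    (∀ Q ∈ (q : Ultrafilter X), Metric.cthickening ε Q ∈ (p : Ultrafilter X))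

/-- The equivalence relation `s` is closed in `X♯ × X♯` and contains parallelity. -/
def IsClosedParallelExtension {X : Type u} [MetricSpace X] (s : Setoid (Sharp X)) : Prop :=
  IsClosed {z : Sharp X × Sharp X | s z.1 z.2} ∧ ∀ p q : Sharp X, Parallel p q → s p q

/-- The smallest closed equivalence relation on `X♯` that contains parallelity. -/
def coronaSetoid (X : Type u) [MetricSpace X] : Setoid (Sharp X) :=
  sInf {s | IsClosedParallelExtension s}

theorem isLeast_coronaSetoid (X : Type u) [MetricSpace X] :
    IsLeast {s : Setoid (Sharp X) | IsClosedParallelExtension s} (coronaSetoid X) := by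
  refine ⟨⟨?_, fun p q h s hs => hs.2 p q h⟩, fun s hs => sInf_le hs⟩
  have h : {z : Sharp X × Sharp X | coronaSetoid X z.1 z.2} =
      ⋂ s ∈ {s : Setoid (Sharp X) | IsClosedParallelExtension s},
        {z : Sharp X × Sharp X | s z.1 z.2} := by
    ext z
    simp only [Set.mem_iInter]
    exact Iff.rfl
  rw [h]
  exact isClosed_biInter fun s hs => hs.1

/-- The corona of `X`: the quotient space of `X♯` by the smallest closed equivalence relation
that contains parallelity, with the quotient topology. -/
abbrev Corona (X : Type u) [MetricSpace X] : Type u := Quotient (coronaSetoid X)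

theorem corona_nonempty (X : Type u) [MetricSpace X]
    (hX : ¬ Bornology.IsBounded (Set.univ : Set X)) : Nonempty (Corona X) := by
  have : (Bornology.cobounded X).NeBot := by
    rw [Filter.neBot_iff]
    intro h
    exact hX (Bornology.isBounded_univ.2 (Bornology.cobounded_eq_bot_iff.1 h))
  exact ⟨Quotient.mk _ ⟨Ultrafilter.of (Bornology.cobounded X),
    fun B hB => Ultrafilter.of_le _ hB.compl⟩⟩

/-- `X` has asymptotically isolated balls: for some finite `ε` and every finite `δ ≥ ε` there is
a point `x` whose closed balls of radii `ε` and `δ` coincide. -/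
def HasAsymptoticallyIsolatedBalls (X : Type u) [MetricSpace X] : Prop :=
  ∃ ε : ℝ, 0 ≤ ε ∧ ∀ δ : ℝ, ε ≤ δ → ∃ x : X, Metric.closedBall x ε = Metric.closedBall x δ

/-- The Stone–Čech remainder `ω* = βω \ ω`: the space of nonprincipal ultrafilters on `ℕ`. -/
abbrev OmegaStar : Type := ((Set.range (pure : ℕ → Ultrafilter ℕ))ᶜ : Set (Ultrafilter ℕ))

theorem omegaStar_nonempty : Nonempty OmegaStar := by
  refine ⟨⟨hyperfilter ℕ, ?_⟩⟩
  rintro ⟨n, hn⟩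
  have h : {n} ∈ hyperfilter ℕ := by
    rw [← hn]
    exact Ultrafilter.mem_pure.2 rfl
  exact notMem_hyperfilter_of_finite (Set.finite_singleton n) h

/-- The cardinal `𝔲`: the minimal character of `ω*`. -/
noncomputable def cardinalU : Cardinal.{0} := minCharacter OmegaStar

/-- The dominating number `𝔡`: the cofinality of the set of functions `ℕ → ℕ` with the
pointwise order. -/
noncomputable def cardinalD : Cardinal.{0} := Order.cof (ℕ → ℕ)

/-! The corona is governed by the relation of asymptotic disjointness. This relation is normal
(`exists_separation`), so having no asymptotically disjoint members is a closed equivalence relation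
on ultrafilters. It lies in the closure of parallelity, hence it is the corona relation
(`coronaSetoid_eq_asymptoticSetoid`). By compactness, the character at the class of `p` is the least
size of a family generating `asymptoticFilter p` modulo bounded sets.

Lower bounds. The function `√(dist x o)` varies slowly at infinity, so a rounded version of it
pushes `p` to a nonprincipal ultrafilter on `ℕ` and carries bases to bases; this gives `𝔲`. Without
asymptotically isolated balls, any growth rate admits two asymptotically separated sets so dense
that the complement of one of them lies in the filter of `p` but contains no `n`-ball centered
within the prescribed radius, for large `n`. The positions of `n`-balls inside the members of a base
therefore form a dominating family; this gives `𝔡`.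

Upper bounds. An ultrafilter of character `𝔲` is transported along a sequence tending to infinity.
Neighborhoods are unions of balls around the sequence, indexed by a base of the ultrafilter and by
functions controlling how slowly the radii grow, which costs `max 𝔲 𝔡`. If the sequence consists of
centers of ever more isolated balls, the radius can stay fixed and the functions disappear. -/

/-! ### Asymptotic disjointness and asymptotic filters -/

/-- Two sets are asymptotically disjoint if, for every `ε`, only a bounded part of the first one
is at distance at most `ε` from the second one. -/
def AsymptoticallyDisjoint {X : Type u} [MetricSpace X] (P Q : Set X) : Prop :=
  ∀ ε : ℝ, Bornology.IsBounded {x | x ∈ P ∧ ∃ y ∈ Q, dist x y ≤ ε}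

namespace AsymptoticallyDisjoint

variable {X : Type u} [MetricSpace X] {P Q P' Q' : Set X}

theorem symm (h : AsymptoticallyDisjoint P Q) : AsymptoticallyDisjoint Q P := by
  intro ε
  refine ((h ε).cthickening (δ := ε)).subset ?_
  rintro x ⟨hx, y, hy, hxy⟩
  exact Metric.mem_cthickening_of_dist_le x y ε _ ⟨hy, x, hx, by rwa [dist_comm]⟩ hxy

theorem mono (h : AsymptoticallyDisjoint P Q) (hP : P' ⊆ P) (hQ : Q' ⊆ Q) :
    AsymptoticallyDisjoint P' Q' :=
  fun ε => (h ε).subset fun _ ⟨hx, y, hy, hxy⟩ => ⟨hP hx, y, hQ hy, hxy⟩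

theorem isBounded_inter (h : AsymptoticallyDisjoint P Q) : Bornology.IsBounded (P ∩ Q) :=
  (h 0).subset fun x hx => ⟨hx.1, x, hx.2, (dist_self x).le⟩

/-- Normality: asymptotically disjoint sets are asymptotically separated by a partition. -/
theorem exists_separation (h : AsymptoticallyDisjoint P Q) :
    ∃ E : Set X, AsymptoticallyDisjoint P Eᶜ ∧ AsymptoticallyDisjoint E Q := by
  -- Points at least as close to `P` as to `Q`. A point of `P` that is `ε`-near the complement is
  -- within about `2 * ε` of `Q`, and symmetrically; the extra `1` makes up for infima that are not
  -- attained.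
  refine ⟨{x | Metric.infEDist x P ≤ Metric.infEDist x Q}, fun ε => ?_, symm fun ε => ?_⟩
  · refine (h (ε + (ε + 1))).subset ?_
    rintro x ⟨hx, y, hy, hxy⟩
    have h1 : Metric.infEDist y Q < ENNReal.ofReal (ε + 1) := by
      refine lt_of_lt_of_le (not_le.1 hy) ((Metric.infEDist_le_edist_of_mem hx).trans ?_)
      rw [edist_comm, edist_dist]
      exact ENNReal.ofReal_le_ofReal (by linarith)
    obtain ⟨z, hz, hyz⟩ := Metric.infEDist_lt_iff.1 h1
    rw [edist_dist, ENNReal.ofReal_lt_ofReal_iff_of_nonneg dist_nonneg] at hyz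
    exact ⟨hx, z, hz, (dist_triangle x y z).trans (by linarith)⟩
  · refine (h.symm (ε + (ε + 1))).subset ?_
    rintro x ⟨hx, y, hy, hxy⟩
    have h1 : Metric.infEDist y P < ENNReal.ofReal (ε + 1) := by
      refine lt_of_le_of_lt (le_trans hy (Metric.infEDist_le_edist_of_mem hx)) ?_
      rw [edist_comm, edist_dist]
      exact (ENNReal.ofReal_lt_ofReal_iff (by linarith [dist_nonneg (x := x) (y := y)])).2
        (by linarith)
    obtain ⟨z, hz, hyz⟩ := Metric.infEDist_lt_iff.1 h1
    rw [edist_dist, ENNReal.ofReal_lt_ofReal_iff_of_nonneg dist_nonneg] at hyz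
    exact ⟨hx, z, hz, (dist_triangle x y z).trans (by linarith)⟩

end AsymptoticallyDisjoint

/-- The filter of sets that asymptotically surround a member of `p`. -/
def asymptoticFilter {X : Type u} [MetricSpace X] (p : Filter X) : Filter X where
  sets := {A | ∃ P ∈ p, AsymptoticallyDisjoint P Aᶜ}
  univ_sets := ⟨Set.univ, univ_mem, fun ε => by simp⟩
  sets_of_superset := by
    rintro A B ⟨P, hP, h⟩ hAB
    exact ⟨P, hP, h.mono subset_rfl (Set.compl_subset_compl.2 hAB)⟩
  inter_sets := by
    rintro A B ⟨P, hP, hA⟩ ⟨Q, hQ, hB⟩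
    refine ⟨P ∩ Q, inter_mem hP hQ, fun ε => ((hA ε).union (hB ε)).subset ?_⟩
    rintro x ⟨hx, y, hy, hxy⟩
    rw [Set.compl_inter] at hy
    exact hy.imp (fun h => ⟨hx.1, y, h, hxy⟩) (fun h => ⟨hx.2, y, h, hxy⟩)

section AsymptoticFilter

variable {X : Type u} [MetricSpace X] {p q r : Sharp X} {A B : Set X}

theorem mem_of_isBounded_diff (p : Sharp X) (hA : A ∈ (p : Ultrafilter X))
    (h : Bornology.IsBounded (A \ B)) : B ∈ (p : Ultrafilter X) :=
  mem_of_superset (inter_mem hA (p.2 _ h)) fun x hx => by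
    by_contra hxB
    exact hx.2 ⟨hx.1, hxB⟩

theorem not_isBounded_of_mem (p : Sharp X) (hA : A ∈ (p : Ultrafilter X)) :
    ¬ Bornology.IsBounded A := fun h =>
  Ultrafilter.empty_notMem (mem_of_isBounded_diff (B := ∅) p hA (by simpa using h))

theorem le_asymptoticFilter (p : Sharp X) :
    ((p : Ultrafilter X) : Filter X) ≤ asymptoticFilter (p : Ultrafilter X) := by
  rintro A ⟨P, hP, h⟩
  exact mem_of_isBounded_diff p hP h.isBounded_inter

theorem exists_sharp_mem (hA : ¬ Bornology.IsBounded A) :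
    ∃ p : Sharp X, A ∈ (p : Ultrafilter X) := by
  have : (Bornology.cobounded X ⊓ 𝓟 A).NeBot := by
    rw [Filter.inf_principal_neBot_iff]
    intro U hU
    by_contra hne
    refine hA ((Bornology.isBounded_compl_iff.2 hU).subset fun x hx hxU => hne ⟨x, hxU, hx⟩)
  refine ⟨⟨Ultrafilter.of (Bornology.cobounded X ⊓ 𝓟 A), fun B hB => ?_⟩, ?_⟩
  · exact Ultrafilter.of_le _ (mem_inf_of_left hB.compl)
  · exact Ultrafilter.of_le _ (mem_inf_of_right (mem_principal_self A))

/-- An ultrafilter contains the asymptotic filter of another one if and only if no member of the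
first is asymptotically disjoint from a member of the second. -/
theorem le_asymptoticFilter_iff :
    ((q : Ultrafilter X) : Filter X) ≤ asymptoticFilter (p : Ultrafilter X) ↔
      ∀ P ∈ (p : Ultrafilter X), ∀ Q ∈ (q : Ultrafilter X), ¬ AsymptoticallyDisjoint P Q := by
  constructor
  · intro h P hP Q hQ hPQ
    have : Qᶜ ∈ (q : Ultrafilter X) := h ⟨P, hP, by rwa [compl_compl]⟩
    exact Ultrafilter.compl_notMem_iff.2 hQ this
  · rintro h A ⟨P, hP, hPA⟩
    by_contra hA
    exact h P hP _ (Ultrafilter.compl_mem_iff_notMem.2 hA) hPA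

/-- Normality yields transitivity of asymptotic equivalence: the separating set `E` belongs to `q`
and is itself a witness for `A`. -/
theorem asymptoticFilter_le_of_le
    (h : ((q : Ultrafilter X) : Filter X) ≤ asymptoticFilter (p : Ultrafilter X)) :
    asymptoticFilter ((q : Ultrafilter X) : Filter X) ≤
      asymptoticFilter (p : Ultrafilter X) := by
  rintro A ⟨P, hP, hPA⟩
  obtain ⟨E, hPE, hEA⟩ := hPA.exists_separation
  exact ⟨E, h ⟨P, hP, hPE⟩, hEA⟩

end AsymptoticFilter

/-- Asymptotic equivalence of ultrafilters: no member of the first one is asymptotically disjoint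
from a member of the second one. -/
def asymptoticSetoid (X : Type u) [MetricSpace X] : Setoid (Sharp X) where
  r p q := ((q : Ultrafilter X) : Filter X) ≤ asymptoticFilter (p : Ultrafilter X)
  iseqv := by
    refine ⟨le_asymptoticFilter, fun {p q} h => ?_, fun {p q r} h h' =>
      h'.trans (asymptoticFilter_le_of_le h)⟩
    rw [le_asymptoticFilter_iff] at h ⊢
    exact fun Q hQ P hP hPQ => h P hP Q hQ hPQ.symm

/-! ### The corona relation and neighborhoods in the corona -/

section Corona

variable {X : Type u} [MetricSpace X] {p q : Sharp X} {A B : Set X}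

theorem isClopen_sharp_mem (A : Set X) : IsClopen {p : Sharp X | A ∈ (p : Ultrafilter X)} :=
  ⟨(ultrafilter_isClosed_basic A).preimage continuous_subtype_val,
    (ultrafilter_isOpen_basic A).preimage continuous_subtype_val⟩

instance : CompactSpace (Sharp X) := by
  refine isCompact_iff_compactSpace.1 (IsClosed.isCompact ?_)
  have : sharpSet X = ⋂ B ∈ {B : Set X | Bornology.IsBounded B}, {p | Bᶜ ∈ p} := by
    ext p
    simp [sharpSet]
  rw [this]
  exact isClosed_biInter fun B _ => ultrafilter_isClosed_basic _

theorem exists_mem_setOf_sharp_subset {O : Set (Sharp X)} (hO : O ∈ 𝓝 p) :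
    ∃ A ∈ (p : Ultrafilter X), ∀ q : Sharp X, A ∈ (q : Ultrafilter X) → q ∈ O := by
  obtain ⟨V, hV, hVO⟩ := mem_nhds_subtype _ _ _ |>.1 hO
  obtain ⟨_, ⟨A, rfl⟩, hA, hAV⟩ := ultrafilterBasis_is_basis.mem_nhds_iff.1 hV
  exact ⟨A, hA, fun q hq => hVO (hAV hq)⟩

/-- Inequivalence is witnessed by one pair of asymptotically disjoint members, and the same pair
works for all nearby ultrafilters. For parallel ultrafilters, the part of `Q` near `P` belongs to
`q`, so it is unbounded. -/
theorem isClosedParallelExtension_asymptoticSetoid :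
    IsClosedParallelExtension (asymptoticSetoid X) := by
  constructor
  · rw [← isOpen_compl_iff, isOpen_iff_mem_nhds]
    rintro ⟨p, q⟩ hpq
    have h : ¬ ∀ P ∈ (p : Ultrafilter X), ∀ Q ∈ (q : Ultrafilter X),
        ¬ AsymptoticallyDisjoint P Q := fun h => hpq (le_asymptoticFilter_iff.2 h)
    push Not at h
    obtain ⟨P, hP, Q, hQ, hPQ⟩ := h
    refine mem_of_superset (prod_mem_nhds ((isClopen_sharp_mem P).2.mem_nhds hP)
      ((isClopen_sharp_mem Q).2.mem_nhds hQ)) ?_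
    rintro ⟨p', q'⟩ ⟨hp', hq'⟩ h'
    exact le_asymptoticFilter_iff.1 h' P hp' Q hq' hPQ
  · rintro p q ⟨ε, hε, h, -⟩
    refine le_asymptoticFilter_iff.2 fun P hP Q hQ hPQ => ?_
    refine not_isBounded_of_mem q (inter_mem hQ (h P hP)) ((hPQ.symm (ε + 1)).subset ?_)
    rintro x ⟨hxQ, hxP⟩
    obtain ⟨y, hy, hxy⟩ := Metric.infEDist_lt_iff.1 (lt_of_le_of_lt (Metric.mem_cthickening_iff.1 hxP)
      ((ENNReal.ofReal_lt_ofReal_iff (by linarith)).2 (lt_add_one ε)))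
    rw [edist_dist, ENNReal.ofReal_lt_ofReal_iff_of_nonneg dist_nonneg] at hxy
    exact ⟨hxQ, y, hy, hxy.le⟩

/-- Unboundedly many points of `P` have a partner in `Q` at distance at most `ε`. An ultrafilter on
these points and its image under a choice of partners are parallel, because the choice moves points
by at most `ε`. -/
theorem exists_parallel_of_not_asymptoticallyDisjoint {P Q : Set X}
    (h : ¬ AsymptoticallyDisjoint P Q) :
    ∃ p q : Sharp X, P ∈ (p : Ultrafilter X) ∧ Q ∈ (q : Ultrafilter X) ∧ Parallel p q := by
  simp only [AsymptoticallyDisjoint, not_forall] at h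
  obtain ⟨ε, hε⟩ := h
  obtain ⟨p, hp⟩ := exists_sharp_mem hε
  have hex : ∀ x, ∃ y, x ∈ {x | x ∈ P ∧ ∃ y ∈ Q, dist x y ≤ ε} → y ∈ Q ∧ dist x y ≤ ε := by
    intro x
    by_cases hx : x ∈ {x | x ∈ P ∧ ∃ y ∈ Q, dist x y ≤ ε}
    · obtain ⟨-, y, hy⟩ := hx
      exact ⟨y, fun _ => hy⟩
    · exact ⟨x, fun h => absurd h hx⟩
  choose f hf using hex
  refine ⟨p, ⟨(p : Ultrafilter X).map f, fun B hB => ?_⟩,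
    mem_of_superset hp fun x hx => hx.1, ?_, max ε 1, by positivity, ?_, ?_⟩
  · rw [Ultrafilter.mem_map]
    refine mem_of_isBounded_diff p hp ((hB.cthickening (δ := ε)).subset ?_)
    rintro x ⟨hx, hxB⟩
    exact Metric.mem_cthickening_of_dist_le x (f x) ε B (by simpa using hxB) (hf x hx).2
  · rw [Ultrafilter.mem_map]
    exact mem_of_superset hp fun x hx => (hf x hx).1
  · intro A hA
    rw [Ultrafilter.mem_map]
    refine mem_of_superset (inter_mem hp hA) ?_
    rintro x ⟨hx, hxA⟩
    refine Metric.mem_cthickening_of_dist_le (f x) x _ A hxA ?_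
    rw [dist_comm]
    exact (hf x hx).2.trans (le_max_left _ _)
  · intro A hA
    rw [Ultrafilter.mem_map] at hA
    refine mem_of_superset (inter_mem hp hA) ?_
    rintro x ⟨hx, hxA⟩
    exact Metric.mem_cthickening_of_dist_le x (f x) _ A hxA ((hf x hx).2.trans (le_max_left _ _))

/-- Every basic neighborhood of an equivalent pair is given by members `P`, `Q` that are not
asymptotically disjoint, so it contains a parallel pair. Equivalent pairs are thus limits of
parallel ones. -/
theorem coronaSetoid_eq_asymptoticSetoid : coronaSetoid X = asymptoticSetoid X := by
  refine le_antisymm ((isLeast_coronaSetoid X).2 isClosedParallelExtension_asymptoticSetoid) ?_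
  intro p q hpq
  obtain ⟨hcl, hpar⟩ := (isLeast_coronaSetoid X).1
  change (p, q) ∈ {z : Sharp X × Sharp X | coronaSetoid X z.1 z.2}
  rw [← hcl.closure_eq, mem_closure_iff_nhds]
  intro U hU
  obtain ⟨V, hV, W, hW, hVW⟩ := mem_nhds_prod_iff.1 hU
  obtain ⟨P, hP, hPV⟩ := exists_mem_setOf_sharp_subset hV
  obtain ⟨Q, hQ, hQW⟩ := exists_mem_setOf_sharp_subset hW
  obtain ⟨p', q', hp', hq', h⟩ := exists_parallel_of_not_asymptoticallyDisjoint
    (le_asymptoticFilter_iff.1 hpq P hP Q hQ)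
  exact ⟨(p', q'), hVW ⟨hPV _ hp', hQW _ hq'⟩, hpar _ _ h⟩

theorem corona_mk_eq_iff : (Quotient.mk (coronaSetoid X) p = Quotient.mk (coronaSetoid X) q) ↔
    ((q : Ultrafilter X) : Filter X) ≤ asymptoticFilter (p : Ultrafilter X) := by
  rw [Quotient.eq, coronaSetoid_eq_asymptoticSetoid]
  exact Iff.rfl

/-- A set that belongs to the asymptotic filter of `p` determines a neighborhood of the class of
`p` in the corona. -/
theorem setOf_mem_asymptoticFilter_mem_nhds (hA : A ∈ asymptoticFilter (p : Ultrafilter X)) :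
    Quotient.mk (coronaSetoid X) '' {q : Sharp X | A ∈ asymptoticFilter (q : Ultrafilter X)} ∈
      𝓝 (Quotient.mk (coronaSetoid X) p : Corona X) := by
  refine IsOpen.mem_nhds ?_ ⟨p, hA, rfl⟩
  refine isOpen_coinduced.2 (isOpen_iff_mem_nhds.2 ?_)
  rintro q ⟨r, ⟨R, hR, hRA⟩, hrq⟩
  -- Membership of `E` is an open condition, holds at `q`, and forces `A` into the asymptotic
  -- filter.
  obtain ⟨E, hRE, hEA⟩ := hRA.exists_separation
  have hE : E ∈ (q : Ultrafilter X) := corona_mk_eq_iff.1 hrq ⟨R, hR, hRE⟩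
  exact mem_of_superset ((isClopen_sharp_mem E).2.mem_nhds hE) fun q' hq' =>
    ⟨q', ⟨E, hq', hEA⟩, rfl⟩

theorem mem_of_mk_mem_image
    (h : Quotient.mk (coronaSetoid X) q ∈
      Quotient.mk (coronaSetoid X) '' {q : Sharp X | A ∈ asymptoticFilter (q : Ultrafilter X)}) :
    A ∈ (q : Ultrafilter X) := by
  obtain ⟨r, hr, hrq⟩ := h
  exact corona_mk_eq_iff.1 hrq hr

/-- If every `A` failed, compactness would give an ultrafilter that contains the whole filter of
`p`, hence is equivalent to `p`, but has its class outside an open neighborhood of the class of `p`.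
-/
theorem exists_mem_asymptoticFilter_of_mem_nhds {O : Set (Corona X)}
    (hO : O ∈ 𝓝 (Quotient.mk (coronaSetoid X) p : Corona X)) :
    ∃ A ∈ asymptoticFilter (p : Ultrafilter X),
      ∀ q : Sharp X, A ∈ (q : Ultrafilter X) → Quotient.mk (coronaSetoid X) q ∈ O := by
  obtain ⟨V, hVO, hV, hpV⟩ := mem_nhds_iff.1 hO
  have hV' : IsOpen (Quotient.mk (coronaSetoid X) ⁻¹' V) := hV.preimage continuous_quotient_mk'
  by_contra! hcon
  have hne : (⋂ A : {A // A ∈ asymptoticFilter ((p : Ultrafilter X) : Filter X)},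
      ({q : Sharp X | A.1 ∈ (q : Ultrafilter X)} ∩
        (Quotient.mk (coronaSetoid X) ⁻¹' V)ᶜ)).Nonempty := by
    have : Nonempty {A // A ∈ asymptoticFilter ((p : Ultrafilter X) : Filter X)} :=
      ⟨⟨_, univ_mem⟩⟩
    refine IsCompact.nonempty_iInter_of_directed_nonempty_isCompact_isClosed _ ?_ ?_ ?_ ?_
    · rintro ⟨A, hA⟩ ⟨B, hB⟩
      refine ⟨⟨A ∩ B, inter_mem hA hB⟩, ?_, ?_⟩ <;> rintro q ⟨hq, hqV⟩
      · exact ⟨mem_of_superset hq Set.inter_subset_left, hqV⟩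
      · exact ⟨mem_of_superset hq Set.inter_subset_right, hqV⟩
    · rintro ⟨A, hA⟩
      obtain ⟨q, hq, hqO⟩ := hcon A hA
      exact ⟨q, hq, fun h => hqO (hVO h)⟩
    · exact fun A => ((isClopen_sharp_mem A.1).1.inter hV'.isClosed_compl).isCompact
    · exact fun A => (isClopen_sharp_mem A.1).1.inter hV'.isClosed_compl
  obtain ⟨q, hq⟩ := hne
  rw [Set.mem_iInter] at hq
  refine (hq ⟨_, univ_mem⟩).2 ?_
  have : Quotient.mk (coronaSetoid X) p = Quotient.mk (coronaSetoid X) q :=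
    corona_mk_eq_iff.2 fun A hA => (hq ⟨A, hA⟩).1
  rw [Set.mem_preimage, ← this]
  exact hpV

end Corona

/-! ### Characters as sizes of generating families of sets -/

section Character

variable {T : Type u} [TopologicalSpace T]

theorem exists_hasBasis_mk_eq_pointCharacter (x : T) :
    ∃ B : Set (Set T), (𝓝 x).HasBasis (fun U : Set T => U ∈ B) id ∧
      Cardinal.mk B = pointCharacter x :=
  csInf_mem (s := {κ : Cardinal.{u} | ∃ B : Set (Set T),
    (𝓝 x).HasBasis (fun U : Set T => U ∈ B) id ∧ Cardinal.mk B = κ})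
    ⟨_, {U | U ∈ 𝓝 x}, (𝓝 x).basis_sets, rfl⟩

theorem exists_pointCharacter_eq_minCharacter (T : Type u) [TopologicalSpace T] [Nonempty T] :
    ∃ x : T, pointCharacter x = minCharacter T :=
  csInf_mem (Set.range_nonempty fun x : T => pointCharacter x)

theorem minCharacter_le (x : T) : minCharacter T ≤ pointCharacter x :=
  csInf_le' ⟨x, rfl⟩

theorem lift_pointCharacter_le {ι : Type*} (x : T) (W : ι → Set T) (hW : ∀ i, W i ∈ 𝓝 x)
    (h : ∀ O ∈ 𝓝 x, ∃ i, W i ⊆ O) :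
    Cardinal.lift (pointCharacter x) ≤ Cardinal.lift.{u} (Cardinal.mk ι) := by
  have hB : (𝓝 x).HasBasis (fun U : Set T => U ∈ Set.range W) id := by
    refine ⟨fun O => ⟨fun hO => ?_, ?_⟩⟩
    · obtain ⟨i, hi⟩ := h O hO
      exact ⟨W i, ⟨i, rfl⟩, hi⟩
    · rintro ⟨_, ⟨i, rfl⟩, hi⟩
      exact mem_of_superset (hW i) hi
  have hle : pointCharacter x ≤ Cardinal.mk (Set.range W) := csInf_le' ⟨_, hB, rfl⟩
  exact (Cardinal.lift_le.2 hle).trans Cardinal.mk_range_le_lift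

end Character

section CoronaCharacter

variable {X : Type u} [MetricSpace X]

theorem pointCharacter_corona_le {ι : Type} (p : Sharp X) (F : ι → Set X)
    (hF : ∀ i, F i ∈ asymptoticFilter (p : Ultrafilter X))
    (h : ∀ A ∈ asymptoticFilter ((p : Ultrafilter X) : Filter X),
      ∃ i, Bornology.IsBounded (F i \ A)) :
    pointCharacter (Quotient.mk (coronaSetoid X) p : Corona X) ≤
      Cardinal.lift.{u} (Cardinal.mk ι) := by
  rw [← Cardinal.lift_id'.{0, u} (pointCharacter _)]
  refine lift_pointCharacter_le _
    (fun i => Quotient.mk (coronaSetoid X) ''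
      {q : Sharp X | F i ∈ asymptoticFilter (q : Ultrafilter X)})
    (fun i => setOf_mem_asymptoticFilter_mem_nhds (hF i)) fun O hO => ?_
  obtain ⟨A, hA, hAO⟩ := exists_mem_asymptoticFilter_of_mem_nhds hO
  obtain ⟨i, hi⟩ := h A hA
  refine ⟨i, ?_⟩
  rintro _ ⟨q, hq, rfl⟩
  exact hAO q (mem_of_isBounded_diff q (le_asymptoticFilter q hq) hi)

theorem exists_family_mk_eq_pointCharacter_corona (p : Sharp X) :
    ∃ (ι : Type u) (F : ι → Set X), (∀ i, F i ∈ asymptoticFilter (p : Ultrafilter X)) ∧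
      (∀ A ∈ asymptoticFilter ((p : Ultrafilter X) : Filter X),
        ∃ i, Bornology.IsBounded (F i \ A)) ∧
      Cardinal.mk ι = pointCharacter (Quotient.mk (coronaSetoid X) p : Corona X) := by
  obtain ⟨B, hB, hcard⟩ :=
    exists_hasBasis_mk_eq_pointCharacter (Quotient.mk (coronaSetoid X) p : Corona X)
  choose F hF hFB using fun U : B =>
    exists_mem_asymptoticFilter_of_mem_nhds (hB.mem_of_mem U.2)
  refine ⟨B, F, hF, fun A hA => ?_, hcard⟩
  obtain ⟨U, hU, hUA⟩ := hB.mem_iff.1 (setOf_mem_asymptoticFilter_mem_nhds hA)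
  refine ⟨⟨U, hU⟩, ?_⟩
  -- An ultrafilter on an unbounded difference would have its class in the basic neighborhood `U`
  -- but not in the one determined by `A`.
  by_contra hb
  obtain ⟨q, hq⟩ := exists_sharp_mem hb
  have hqA : A ∈ (q : Ultrafilter X) :=
    mem_of_mk_mem_image (hUA (hFB ⟨U, hU⟩ q (mem_of_superset hq Set.sdiff_subset)))
  exact Ultrafilter.compl_notMem_iff.2 hqA (mem_of_superset hq fun x hx => hx.2)

end CoronaCharacter

section OmegaStar

theorem compl_mem_of_finite (v : OmegaStar) {s : Set ℕ} (hs : s.Finite) :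
    sᶜ ∈ (v : Ultrafilter ℕ) := by
  by_contra h
  obtain ⟨n, -, hn⟩ := Ultrafilter.eq_pure_of_finite_mem hs (Ultrafilter.compl_notMem_iff.1 h)
  exact v.2 ⟨n, hn.symm⟩

theorem mem_of_finite_diff (v : OmegaStar) {s t : Set ℕ} (hs : s ∈ (v : Ultrafilter ℕ))
    (h : (s \ t).Finite) : t ∈ (v : Ultrafilter ℕ) :=
  mem_of_superset (inter_mem hs (compl_mem_of_finite v h)) fun x hx => by
    by_contra hxt
    exact hx.2 ⟨hx.1, hxt⟩

theorem exists_omegaStar_mem {s : Set ℕ} (hs : s.Infinite) :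
    ∃ v : OmegaStar, s ∈ (v : Ultrafilter ℕ) := by
  have := hs.cofinite_inf_principal_neBot
  refine ⟨⟨Ultrafilter.of (cofinite ⊓ 𝓟 s), ?_⟩,
    Ultrafilter.of_le _ (mem_inf_of_right (mem_principal_self s))⟩
  rintro ⟨n, hn⟩
  have h : ({n} : Set ℕ)ᶜ ∈ Ultrafilter.of (cofinite ⊓ 𝓟 s) :=
    Ultrafilter.of_le _ (mem_inf_of_left (Set.finite_singleton n).compl_mem_cofinite)
  rw [← hn] at h
  exact h rfl

theorem setOf_omegaStar_mem_nhds {v : OmegaStar} {s : Set ℕ} (hs : s ∈ (v : Ultrafilter ℕ)) :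
    {w : OmegaStar | s ∈ (w : Ultrafilter ℕ)} ∈ 𝓝 v :=
  ((ultrafilter_isOpen_basic s).preimage continuous_subtype_val).mem_nhds hs

theorem exists_mem_of_mem_nhds_omegaStar {v : OmegaStar} {O : Set OmegaStar} (hO : O ∈ 𝓝 v) :
    ∃ s ∈ (v : Ultrafilter ℕ), {w : OmegaStar | s ∈ (w : Ultrafilter ℕ)} ⊆ O := by
  obtain ⟨V, hV, hVO⟩ := mem_nhds_subtype _ _ _ |>.1 hO
  obtain ⟨_, ⟨s, rfl⟩, hs, hsV⟩ := ultrafilterBasis_is_basis.mem_nhds_iff.1 hV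
  exact ⟨s, hs, fun w hw => hVO (hsV hw)⟩

theorem lift_pointCharacter_omegaStar_le {ι : Type u} (v : OmegaStar) (G : ι → Set ℕ)
    (hG : ∀ i, G i ∈ (v : Ultrafilter ℕ))
    (h : ∀ s ∈ (v : Ultrafilter ℕ), ∃ i, (G i \ s).Finite) :
    Cardinal.lift.{u} (pointCharacter v) ≤ Cardinal.mk ι := by
  rw [← Cardinal.lift_id'.{0, u} (Cardinal.mk ι)]
  refine lift_pointCharacter_le v (fun i => {w : OmegaStar | G i ∈ (w : Ultrafilter ℕ)})
    (fun i => setOf_omegaStar_mem_nhds (hG i)) fun O hO => ?_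
  obtain ⟨s, hs, hsO⟩ := exists_mem_of_mem_nhds_omegaStar hO
  obtain ⟨i, hi⟩ := h s hs
  exact ⟨i, fun w hw => hsO (mem_of_finite_diff w hw hi)⟩

theorem exists_family_mk_eq_pointCharacter_omegaStar (v : OmegaStar) :
    ∃ (ι : Type) (G : ι → Set ℕ), (∀ i, G i ∈ (v : Ultrafilter ℕ)) ∧
      (∀ s ∈ (v : Ultrafilter ℕ), ∃ i, (G i \ s).Finite) ∧
      Cardinal.mk ι = pointCharacter v := by
  obtain ⟨B, hB, hcard⟩ := exists_hasBasis_mk_eq_pointCharacter v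
  choose G hG hGB using fun U : B => exists_mem_of_mem_nhds_omegaStar (hB.mem_of_mem U.2)
  refine ⟨B, G, hG, fun s hs => ?_, hcard⟩
  obtain ⟨U, hU, hUs⟩ := hB.mem_iff.1 (setOf_omegaStar_mem_nhds hs)
  refine ⟨⟨U, hU⟩, ?_⟩
  by_contra hinf
  obtain ⟨w, hw⟩ := exists_omegaStar_mem hinf
  have hws : s ∈ (w : Ultrafilter ℕ) :=
    hUs (hGB ⟨U, hU⟩ (mem_of_superset hw Set.sdiff_subset))
  exact Ultrafilter.compl_notMem_iff.2 hws (mem_of_superset hw fun x hx => hx.2)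

end OmegaStar

theorem infinite_of_eventually_dominating {ι : Type u} (F : ι → ℕ → ℕ)
    (h : ∀ φ : ℕ → ℕ, ∃ i, ∀ᶠ n in atTop, φ n ≤ F i n) : Infinite ι := by
  by_contra hfin
  rw [not_infinite_iff_finite] at hfin
  have := Fintype.ofFinite ι
  obtain ⟨i, hi⟩ := h fun n => ∑ i, F i n + 1
  obtain ⟨n, hn⟩ := hi.exists
  have := Finset.single_le_sum (f := fun i => F i n) (fun _ _ => Nat.zero_le _)
    (Finset.mem_univ i)
  omega

/-- A family of functions that dominates every function from some point on has at least `𝔡`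
members. -/
theorem lift_cardinalD_le {ι : Type u} (F : ι → ℕ → ℕ)
    (h : ∀ φ : ℕ → ℕ, ∃ i, ∀ᶠ n in atTop, φ n ≤ F i n) :
    Cardinal.lift.{u} cardinalD ≤ Cardinal.mk ι := by
  have hinf := infinite_of_eventually_dominating F h
  -- Adding constants turns eventual domination into domination everywhere, without enlarging an
  -- infinite family.
  have hcof : IsCofinal (Set.range fun z : ι × ℕ => fun n => F z.1 n + z.2) := by
    intro φ
    obtain ⟨i, hi⟩ := h φ
    obtain ⟨N, hN⟩ := eventually_atTop.1 hi
    refine ⟨_, ⟨(i, ∑ n ∈ Finset.range N, φ n), rfl⟩, fun n => ?_⟩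
    rcases le_or_gt N n with hn | hn
    · exact (hN n hn).trans (Nat.le_add_right _ _)
    · exact (Finset.single_le_sum (f := φ) (fun _ _ => Nat.zero_le _)
        (Finset.mem_range.2 hn)).trans (Nat.le_add_left _ _)
  refine (Cardinal.lift_le.2 (Order.cof_le hcof)).trans (Cardinal.mk_range_le_lift.trans ?_)
  have hι : Cardinal.aleph0 ≤ Cardinal.mk ι := Cardinal.aleph0_le_mk ι
  simp [Cardinal.mul_aleph0_eq hι]

/-! ### Lower bounds by `𝔲` and by `𝔡` -/

section LowerBounds

variable {X : Type u} [MetricSpace X]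

theorem exists_nat_add_quarter_le {a : ℝ} (ha : 0 ≤ a) :
    (∃ m : ℕ, m + 1 / 4 ≤ a + 0 ∧ a + 0 ≤ m + 3 / 4) ∨
      ∃ m : ℕ, m + 1 / 4 ≤ a + 1 / 2 ∧ a + 1 / 2 ≤ m + 3 / 4 := by
  have h1 := Nat.floor_le ha
  have h2 := Nat.lt_floor_add_one a
  rcases lt_or_ge a (⌊a⌋₊ + 1 / 4) with h | h
  · exact Or.inr ⟨⌊a⌋₊, by linarith, by linarith⟩
  rcases le_or_gt a (⌊a⌋₊ + 3 / 4) with h' | h'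
  · exact Or.inl ⟨⌊a⌋₊, by linarith, by linarith⟩
  · exact Or.inr ⟨⌊a⌋₊ + 1, by push_cast; linarith, by push_cast; linarith⟩

/-- The map is the integer part of `√(dist x o) + c`. The shift `c`, either `0` or `1 / 2`, is
chosen so that `p` concentrates on points whose value is at least `1 / 4` away from the integers,
where the integer part jumps. Since the square root varies slowly, far out an `ε`-step from such a
point does not change the integer part. -/
theorem exists_tame_map (p : Sharp X) :
    ∃ f : X → ℕ, (∀ B : Set X, Bornology.IsBounded B → (f '' B).Finite) ∧
      (∀ n, Bornology.IsBounded (f ⁻¹' {n})) ∧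
      ∀ s : Set ℕ, f ⁻¹' s ∈ (p : Ultrafilter X) →
        f ⁻¹' s ∈ asymptoticFilter (p : Ultrafilter X) := by
  obtain ⟨o, -⟩ := Ultrafilter.nonempty_of_mem (p.1.univ_mem)
  obtain ⟨c, hc0, hc⟩ : ∃ c : ℝ, 0 ≤ c ∧ {x : X | ∃ m : ℕ, m + 1 / 4 ≤ √(dist x o) + c ∧
      √(dist x o) + c ≤ m + 3 / 4} ∈ (p : Ultrafilter X) := by
    have h : {x : X | ∃ m : ℕ, m + 1 / 4 ≤ √(dist x o) + 0 ∧ √(dist x o) + 0 ≤ m + 3 / 4} ∪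
        {x : X | ∃ m : ℕ, m + 1 / 4 ≤ √(dist x o) + 1 / 2 ∧
          √(dist x o) + 1 / 2 ≤ m + 3 / 4} ∈ (p : Ultrafilter X) :=
      mem_of_superset univ_mem fun x _ => exists_nat_add_quarter_le (Real.sqrt_nonneg _)
    rcases Ultrafilter.union_mem_iff.1 h with h | h
    · exact ⟨_, le_rfl, h⟩
    · exact ⟨_, by norm_num, h⟩
  refine ⟨fun x => ⌊√(dist x o) + c⌋₊, fun B hB => ?_, fun n => ?_, fun s hs => ?_⟩
  · obtain ⟨r, hr⟩ := (Metric.isBounded_iff_subset_closedBall o).1 hB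
    refine (Set.finite_Iic ⌊√r + c⌋₊).subset ?_
    rintro _ ⟨x, hx, rfl⟩
    exact Nat.floor_le_floor (by gcongr; exact hr hx)
  · refine (Metric.isBounded_iff_subset_closedBall o).2 ⟨(n + 1) ^ 2, fun x hx => ?_⟩
    have h : ⌊√(dist x o) + c⌋₊ = n := hx
    have h1 := Nat.lt_floor_add_one (√(dist x o) + c)
    rw [h] at h1
    exact (Real.sqrt_le_left (by positivity)).1 (by linarith)
  · refine ⟨_, inter_mem hs hc, fun ε => ?_⟩
    -- A change of integer part needs a gap of `1 / 4` between the square roots; the gap times their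
    -- sum is at most `ε`, so `√(dist x o) ≤ 4 * ε`.
    refine (Metric.isBounded_iff_subset_closedBall o).2 ⟨(4 * ε) ^ 2, ?_⟩
    rintro x ⟨⟨hxs, m, hm1, hm2⟩, y, hy, hxy⟩
    have hε : 0 ≤ ε := dist_nonneg.trans hxy
    have hfx : ⌊√(dist x o) + c⌋₊ = m :=
      (Nat.floor_eq_iff (by positivity)).2 ⟨by linarith, by linarith⟩
    have hfy : ⌊√(dist y o) + c⌋₊ ≠ m := by
      rintro h
      apply hy
      change ⌊√(dist y o) + c⌋₊ ∈ s
      rw [h, ← hfx]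
      exact hxs
    have hgap : 1 / 4 ≤ |√(dist x o) - √(dist y o)| := by
      by_contra! hlt
      rw [abs_lt] at hlt
      exact hfy ((Nat.floor_eq_iff (by positivity)).2 ⟨by linarith, by linarith⟩)
    have hprod : |√(dist x o) - √(dist y o)| * (√(dist x o) + √(dist y o)) ≤ ε := by
      rw [← abs_of_nonneg (show 0 ≤ √(dist x o) + √(dist y o) by positivity), ← abs_mul]
      have : (√(dist x o) - √(dist y o)) * (√(dist x o) + √(dist y o)) =
          dist x o - dist y o := by
        linear_combination Real.sq_sqrt (dist_nonneg (x := x) (y := o)) -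
          Real.sq_sqrt (dist_nonneg (x := y) (y := o))
      rw [this]
      exact (abs_dist_sub_le x y o).trans hxy
    refine (Real.sqrt_le_left (by positivity)).1 ?_
    nlinarith [Real.sqrt_nonneg (dist x o), Real.sqrt_nonneg (dist y o)]

/-- The image ultrafilter is nonprincipal because fibers are bounded, and images of a base generate
it modulo finite sets because bounded sets have finite images. -/
theorem lift_cardinalU_le_pointCharacter (p : Sharp X) :
    Cardinal.lift.{u} cardinalU ≤
      pointCharacter (Quotient.mk (coronaSetoid X) p : Corona X) := by
  obtain ⟨ι, F, hF, hFbase, hcard⟩ := exists_family_mk_eq_pointCharacter_corona p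
  obtain ⟨f, hfB, hfn, hfs⟩ := exists_tame_map p
  have hv : (p : Ultrafilter X).map f ∈ (Set.range (pure : ℕ → Ultrafilter ℕ))ᶜ := by
    rintro ⟨n, hn⟩
    refine not_isBounded_of_mem p ?_ (hfn n)
    rw [← Ultrafilter.mem_map, ← hn]
    exact Ultrafilter.mem_pure.2 rfl
  rw [← hcard]
  refine (Cardinal.lift_le.2 (minCharacter_le ⟨_, hv⟩)).trans
    (lift_pointCharacter_omegaStar_le _ (fun i => f '' F i) (fun i => ?_) fun s hs => ?_)
  · exact image_mem_map (le_asymptoticFilter p (hF i))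
  · obtain ⟨i, hi⟩ := hFbase _ (hfs s hs)
    refine ⟨i, (hfB _ hi).subset ?_⟩
    rintro _ ⟨⟨x, hx, rfl⟩, hxs⟩
    exact ⟨x, ⟨hx, hxs⟩, rfl⟩

/-- If `X` has no asymptotically isolated balls, then every growth rate `φ` is slow enough for
two asymptotically separated sets that meet every ball of radius `n` centered in the ball of
radius `φ n`. -/
theorem exists_asymptoticallyDisjoint_dense (h : ¬ HasAsymptoticallyIsolatedBalls X) (o : X)
    (φ : ℕ → ℕ) :
    ∃ S D E : Set X, AsymptoticallyDisjoint E S ∧ AsymptoticallyDisjoint Eᶜ D ∧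
      ∃ N : ℕ, ∀ n ≥ N, ∀ x, dist x o ≤ φ n →
        (∃ s ∈ S, dist s x ≤ n) ∧ ∃ y ∈ D, dist y x ≤ n := by
  have hex : ∀ k : ℕ, ∃ m : ℕ, ∀ x : X, ∃ y, k < dist y x ∧ dist y x ≤ m := by
    intro k
    simp only [HasAsymptoticallyIsolatedBalls, not_exists, not_and, not_forall] at h
    obtain ⟨δ, hδ, hne⟩ := h k (Nat.cast_nonneg k)
    refine ⟨⌈δ⌉₊, fun x => ?_⟩
    by_contra! hcon
    refine hne x ((Metric.closedBall_subset_closedBall hδ).antisymm fun y hy => ?_)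
    by_contra hyk
    exact absurd (hcon y (not_le.1 hyk)) (not_lt.2 (le_trans hy (Nat.le_ceil δ)))
  choose Δ hΔ using hex
  -- `R k` is the scale used in the `k`-th shell around `o`: it leaves room for a point at distance
  -- more than `2 * k + 4` from a given one.
  obtain ⟨R, hRmono, hR⟩ : ∃ R : ℕ → ℕ, Monotone R ∧
      ∀ k, Δ (2 * k + 4) + (2 * k + 4) ≤ R k := by
    refine ⟨fun k => ∑ j ∈ Finset.range (k + 1), (Δ (2 * j + 4) + (2 * j + 4)), ?_, fun k => ?_⟩
    · exact fun a b hab => Finset.sum_le_sum_of_subset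
        (Finset.range_subset_range.2 (Nat.succ_le_succ hab))
    · exact Finset.single_le_sum (f := fun j => Δ (2 * j + 4) + (2 * j + 4))
        (fun _ _ => Nat.zero_le _) (Finset.self_mem_range_succ k)
  -- Radii of the shells. They are thick compared to `R`, so a short step changes the index by at
  -- most one, and they outgrow `φ n` for all `n` below the scale `3 * R (k + 2)`.
  obtain ⟨F, hF0, hFs⟩ : ∃ F : ℕ → ℕ, F 0 = 0 ∧ ∀ k, F (k + 1) =
      F k + 2 * R (k + 1) + 1 + ∑ n ∈ Finset.range (3 * R (k + 2)), φ n :=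
    ⟨fun k => Nat.rec 0 (fun k a =>
      a + 2 * R (k + 1) + 1 + ∑ n ∈ Finset.range (3 * R (k + 2)), φ n) k, rfl, fun _ => rfl⟩
  have hFmono : StrictMono F := strictMono_nat_of_lt_succ fun k => by rw [hFs]; omega
  have hexk : ∀ x : X, ∃ k : ℕ, (F k : ℝ) ≤ dist x o ∧ dist x o < F (k + 1) := by
    intro x
    have hlt : ∃ k : ℕ, dist x o < F (k + 1) := by
      obtain ⟨k, hk⟩ := exists_nat_gt (dist x o)
      refine ⟨k, hk.trans_le ?_⟩
      exact_mod_cast (hFmono.id_le k).trans (hFmono.monotone (Nat.le_succ k))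
    classical
    refine ⟨Nat.find hlt, ?_, Nat.find_spec hlt⟩
    rcases hk : Nat.find hlt with _ | j
    · simp [hF0]
    · exact not_lt.1 (Nat.find_min hlt (m := j) (by omega))
  choose k hk1 hk2 using hexk
  have hjump : ∀ x y, k x ≤ k y + 1 ∨ (2 * R (k x) : ℝ) < dist x y := by
    intro x y
    by_contra! hcon
    obtain ⟨hlt, hle⟩ := hcon
    obtain ⟨j, hj⟩ : ∃ j, k x = j + 1 := ⟨k x - 1, by omega⟩
    have h1 : F (k y + 1) ≤ F j := hFmono.monotone (by omega)
    have h2 : F j + 2 * R (k x) + 1 ≤ F (k x) := by rw [hj, hFs]; omega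
    have h1' : (F (k y + 1) : ℝ) ≤ F j := by exact_mod_cast h1
    have h2' : (F j + 2 * R (k x) + 1 : ℝ) ≤ F (k x) := by exact_mod_cast h2
    linarith [hk1 x, hk2 y, dist_triangle x y o]
  have hbdd : ∀ c : ℝ, Bornology.IsBounded {x | (k x : ℝ) ≤ c} := by
    intro c
    refine (Metric.isBounded_iff_subset_closedBall o).2 ⟨F (⌊c⌋₊ + 1), fun x hx => ?_⟩
    refine (hk2 x).le.trans (Nat.cast_le.2 (hFmono.monotone ?_))
    exact Nat.succ_le_succ (Nat.le_floor hx)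
  have hRk : ∀ k, (Δ (2 * k + 4) + (2 * k + 4) : ℝ) ≤ R k := fun k => by exact_mod_cast hR k
  have hRle : ∀ {a b}, a ≤ b → (R a : ℝ) ≤ R b := fun hab => by exact_mod_cast hRmono hab
  -- A maximal separated set is also a net at the scale `R`.
  obtain ⟨S, hS⟩ := zorn_subset
    {S : Set X | S.Pairwise fun s t => (R (k s) + R (k t) : ℝ) < dist s t}
    fun c hc hchain => ⟨⋃₀ c, (Set.pairwise_sUnion hchain.directedOn).2 hc,
      fun s hs => Set.subset_sUnion_of_mem hs⟩
  have hnet : ∀ x, ∃ s ∈ S, dist s x ≤ R (k s) + R (k x) := by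
    intro x
    by_contra! hcon
    have hins : insert x S ∈
        {S : Set X | S.Pairwise fun s t => (R (k s) + R (k t) : ℝ) < dist s t} := by
      refine hS.prop.insert fun s hs _ => ⟨?_, hcon s hs⟩
      rw [dist_comm, add_comm]
      exact hcon s hs
    have hx : x ∈ S := hS.le_of_ge hins (Set.subset_insert x S) (Set.mem_insert x S)
    have := hcon x hx
    rw [dist_self] at this
    exact absurd this (not_lt.2 (by positivity))
  -- The distance to `S` is compared with the shell index: `E` keeps distance `k` from `S`, and `D`
  -- keeps `2 * k`. Both thresholds tend to infinity, and so does the gap between them.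
  refine ⟨S, {y | ∀ t ∈ S, (2 * k y : ℝ) ≤ dist y t}, {x | ∀ t ∈ S, (k x : ℝ) ≤ dist x t},
    fun ε => (hbdd ε).subset ?_, fun ε => (hbdd (ε + 2)).subset ?_, 3 * R 1, fun n hn x hx => ?_⟩
  · rintro x ⟨hx, y, hy, hxy⟩
    exact (hx y hy).trans hxy
  · rintro x ⟨hx, y, hy, hxy⟩
    simp only [Set.mem_compl_iff, Set.mem_ofPred_eq, not_forall, not_le] at hx
    obtain ⟨t, ht, hxt⟩ := hx
    have h1 := hy t ht
    have h2 := dist_triangle_left y t x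
    change (k x : ℝ) ≤ ε + 2
    rcases hjump x y with h3 | h3
    · have h3' : (k x : ℝ) ≤ k y + 1 := by exact_mod_cast h3
      linarith
    · have := hRk (k x)
      have : (0 : ℝ) ≤ Δ (2 * k x + 4) := Nat.cast_nonneg _
      linarith
  · have hle : 3 * R (k x + 1) ≤ n := by
      rcases hkx : k x with _ | j
      · exact hn
      · by_contra! hlt
        have h1 := Finset.single_le_sum (f := φ) (fun _ _ => Nat.zero_le _)
          (Finset.mem_range.2 (show n < 3 * R (j + 2) from hlt))
        have h2 : φ n < F (k x) := by rw [hkx, hFs]; omega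
        have h2' : (φ n : ℝ) < F (k x) := by exact_mod_cast h2
        linarith [hk1 x]
    have hle' : (3 * R (k x + 1) : ℝ) ≤ n := by exact_mod_cast hle
    obtain ⟨s, hs, hsx⟩ := hnet x
    have hks : k s ≤ k x + 1 := by
      rcases hjump s x with h1 | h1
      · exact h1
      · by_contra! hlt
        have := hRle (show k x ≤ k s by omega)
        linarith
    have hRs := hRle hks
    have hRx := hRle (Nat.le_succ (k x))
    have hR0 : (0 : ℝ) ≤ R (k x + 1) := Nat.cast_nonneg _
    refine ⟨⟨s, hs, by linarith⟩, ?_⟩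
    -- This point lies in `D`: its index is at most `k s + 1`, its distance from `s` exceeds `2 * k
    -- s + 4`, and the separation of `S` keeps it equally far from the other points of `S`.
    obtain ⟨y, hy1, hy2⟩ := hΔ (2 * k s + 4) s
    push_cast at hy1
    have hRks := hRk (k s)
    have hks0 : (0 : ℝ) ≤ k s := Nat.cast_nonneg _
    have hky : k y ≤ k s + 1 := by
      rcases hjump y s with h1 | h1
      · exact h1
      · by_contra! hlt
        have := hRle (show k s ≤ k y by omega)
        linarith [(Nat.cast_nonneg (R (k s)) : (0 : ℝ) ≤ _)]
    have hky' : (k y : ℝ) ≤ k s + 1 := by exact_mod_cast hky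
    refine ⟨y, fun t ht => ?_, by linarith [dist_triangle y s x]⟩
    rcases eq_or_ne s t with rfl | hst
    · linarith
    · have h1 := hS.prop hs ht hst
      have h2 := dist_triangle_left s t y
      linarith [(Nat.cast_nonneg (R (k t)) : (0 : ℝ) ≤ _)]

theorem exists_closedBall_subset_of_mem_asymptoticFilter (p : Sharp X) {A : Set X}
    (hA : A ∈ asymptoticFilter (p : Ultrafilter X)) (o : X) (n : ℕ) :
    ∃ x, Metric.closedBall x n ⊆ A ∧ 2 * n ≤ dist x o := by
  obtain ⟨P, hP, hPA⟩ := hA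
  have hfar : {x : X | 2 * n ≤ dist x o} ∈ (p : Ultrafilter X) :=
    mem_of_superset (p.2 _ (Metric.isBounded_closedBall (x := o) (r := 2 * n))) fun x hx =>
      (not_le.1 (Metric.mem_closedBall.not.1 hx)).le
  obtain ⟨x, ⟨hxP, hxn⟩, hx⟩ :=
    Ultrafilter.nonempty_of_mem (inter_mem (inter_mem hP (p.2 _ (hPA n))) hfar)
  refine ⟨x, fun y hy => ?_, hx⟩
  by_contra hyA
  exact hxn ⟨hxP, y, hyA, by rwa [dist_comm]⟩

theorem lift_cardinalD_le_pointCharacter (h : ¬ HasAsymptoticallyIsolatedBalls X)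
    (p : Sharp X) :
    Cardinal.lift.{u} cardinalD ≤
      pointCharacter (Quotient.mk (coronaSetoid X) p : Corona X) := by
  obtain ⟨o, -⟩ := Ultrafilter.nonempty_of_mem (p.1.univ_mem)
  obtain ⟨ι, F, hF, hFbase, hcard⟩ := exists_family_mk_eq_pointCharacter_corona p
  rw [← hcard]
  choose x hxF hxn using fun i n =>
    exists_closedBall_subset_of_mem_asymptoticFilter p (hF i) o n
  refine lift_cardinalD_le (fun i n => ⌈dist (x i n) o⌉₊) fun φ => ?_
  obtain ⟨S, D, E, hES, hED, N, hN⟩ := exists_asymptoticallyDisjoint_dense h o φ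
  -- The ultrafilter decides between `E` and its complement, and thereby which of `S` and `D` is
  -- asymptotically disjoint from a member of `p`.
  obtain ⟨T, hT, hTN⟩ : ∃ T : Set X, Tᶜ ∈ asymptoticFilter ((p : Ultrafilter X) : Filter X) ∧
      ∀ n ≥ N, ∀ x, dist x o ≤ φ n → ∃ t ∈ T, dist t x ≤ n := by
    rcases Ultrafilter.mem_or_compl_mem (p : Ultrafilter X) E with hE | hE
    · exact ⟨S, ⟨E, hE, by rwa [compl_compl]⟩, fun n hn x hx => (hN n hn x hx).1⟩
    · exact ⟨D, ⟨Eᶜ, hE, by rwa [compl_compl]⟩, fun n hn x hx => (hN n hn x hx).2⟩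
  obtain ⟨i, hi⟩ := hFbase _ hT
  obtain ⟨r, hr⟩ := (Metric.isBounded_iff_subset_closedBall o).1 hi
  refine ⟨i, eventually_atTop.2 ⟨max N (⌊r⌋₊ + 1), fun n hn => ?_⟩⟩
  by_contra! hlt
  -- If the `n`-ball inside `F i` were centered too close to `o`, it would contain a point of `T`.
  -- That point is at distance at least `n` from `o`, because the center is at distance at least `2
  -- * n`, so it escapes the bounded exceptional set.
  obtain ⟨t, ht, htx⟩ := hTN n (le_of_max_le_left hn) (x i n)
    ((Nat.le_ceil _).trans (Nat.cast_le.2 hlt.le))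
  have h1 : dist t o ≤ r := hr ⟨hxF i n htx, fun h => h ht⟩
  have h2 : r < n := (Nat.lt_floor_add_one r).trans_le (by exact_mod_cast le_of_max_le_right hn)
  linarith [hxn i n, dist_triangle_left (x i n) o t]

end LowerBounds

/-! ### Upper bounds by transported ultrafilters -/

section UpperBounds

variable {X : Type u} [MetricSpace X]

/-- The ultrafilter in `X♯` obtained by transporting a nonprincipal ultrafilter along a sequence
that tends to infinity. -/
def sharpMap (v : OmegaStar) (x : ℕ → X) (o : X) (hx : ∀ n : ℕ, (n : ℝ) ≤ dist (x n) o) :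
    Sharp X :=
  ⟨(v : Ultrafilter ℕ).map x, fun B hB => by
    obtain ⟨r, hr⟩ := (Metric.isBounded_iff_subset_closedBall o).1 hB
    rw [Ultrafilter.mem_map]
    refine mem_of_superset (compl_mem_of_finite v (Set.finite_Iic ⌊r⌋₊)) fun n hn hnB => hn ?_
    exact Nat.le_floor ((hx n).trans (hr hnB))⟩

variable {v : OmegaStar} {x : ℕ → X} {o : X} {hx : ∀ n : ℕ, (n : ℝ) ≤ dist (x n) o}

/-- The threshold `m` as a function of the radius `k` is what brings in `𝔡`. -/
theorem mem_asymptoticFilter_sharpMap_iff {A : Set X} :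
    A ∈ asymptoticFilter (sharpMap v x o hx : Ultrafilter X) ↔
      ∃ s ∈ (v : Ultrafilter ℕ), ∀ k : ℕ, ∃ m, ∀ n ∈ s, m ≤ n → Metric.closedBall (x n) k ⊆ A := by
  constructor
  · rintro ⟨P, hP, hPA⟩
    refine ⟨x ⁻¹' P, hP, fun k => ?_⟩
    obtain ⟨r, hr⟩ := (Metric.isBounded_iff_subset_closedBall o).1 (hPA k)
    refine ⟨⌊r⌋₊ + 1, fun n hn hm y hy => ?_⟩
    by_contra hyA
    have h1 : dist (x n) o ≤ r := hr ⟨hn, y, hyA, by rwa [dist_comm]⟩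
    have h2 := Nat.le_floor ((hx n).trans h1)
    omega
  · rintro ⟨s, hs, h⟩
    refine ⟨x '' s, image_mem_map hs, fun ε => ?_⟩
    obtain ⟨m, hm⟩ := h ⌈ε⌉₊
    refine ((Set.finite_Iio m).image x).isBounded.subset ?_
    rintro _ ⟨⟨n, hn, rfl⟩, y, hy, hxy⟩
    refine ⟨n, ?_, rfl⟩
    by_contra hmn
    refine hy (hm n hn (not_lt.1 hmn) ?_)
    rw [Metric.mem_closedBall, dist_comm]
    exact hxy.trans (Nat.le_ceil ε)

theorem pointCharacter_sharpMap_le_max :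
    pointCharacter (Quotient.mk (coronaSetoid X) (sharpMap v x o hx) : Corona X) ≤
      Cardinal.lift.{u} (max (pointCharacter v) cardinalD) := by
  obtain ⟨ι, G, hG, hGbase, hcard⟩ := exists_family_mk_eq_pointCharacter_omegaStar v
  obtain ⟨C, hC, hCcard⟩ := Order.exists_cof_eq (ℕ → ℕ)
  refine (pointCharacter_corona_le (ι := ι × C) _
    (fun i => {y | ∃ n ∈ G i.1, ∃ k : ℕ, i.2.1 k ≤ n ∧ dist y (x n) ≤ k}) ?_ ?_).trans ?_
  · rintro ⟨i, φ, -⟩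
    refine mem_asymptoticFilter_sharpMap_iff.2 ⟨G i, hG i, fun k => ⟨φ k, fun n hn hkn y hy => ?_⟩⟩
    exact ⟨n, hn, k, hkn, hy⟩
  · intro A hA
    obtain ⟨s, hs, h⟩ := mem_asymptoticFilter_sharpMap_iff.1 hA
    obtain ⟨i, hi⟩ := hGbase s hs
    obtain ⟨M, hM⟩ := hi.bddAbove
    choose m hm using h
    -- The bound `M + 1` skips the finitely many elements of `G i` outside `s`, so the inclusion in
    -- `A` holds without a bounded error.
    obtain ⟨φ, hφC, hφ⟩ := hC fun k => max (m k) (M + 1)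
    refine ⟨(i, ⟨φ, hφC⟩), ?_⟩
    convert Bornology.isBounded_empty
    refine Set.sdiff_eq_empty.2 ?_
    rintro y ⟨n, hn, k, hkn, hy⟩
    have hkn' : max (m k) (M + 1) ≤ n := (hφ k).trans hkn
    have hns : n ∈ s := by
      by_contra hns
      have := hM ⟨hn, hns⟩
      omega
    exact hm k n hns (le_of_max_le_left hkn') hy
  · rw [Cardinal.lift_le, Cardinal.mk_prod, Cardinal.lift_id, Cardinal.lift_id, hcard, hCcard]
    have hinf : Infinite C := infinite_of_eventually_dominating (fun φ : C => φ.1) fun φ => by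
      obtain ⟨ψ, hψ, hle⟩ := hC φ
      exact ⟨⟨ψ, hψ⟩, Eventually.of_forall hle⟩
    have hd : Cardinal.aleph0 ≤ Order.cof (ℕ → ℕ) := hCcard ▸ Cardinal.aleph0_le_mk C
    exact Cardinal.mul_le_max_of_aleph0_le_right hd

/-- For `k ≤ n` the `k`-ball around `x n` lies in its `ε`-ball, so unions of `ε`-balls already form
a base and no growth function is needed. -/
theorem pointCharacter_sharpMap_le {ε : ℝ}
    (h : ∀ n : ℕ, Metric.closedBall (x n) ε = Metric.closedBall (x n) (ε + n)) (hε : 0 ≤ ε) :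
    pointCharacter (Quotient.mk (coronaSetoid X) (sharpMap v x o hx) : Corona X) ≤
      Cardinal.lift.{u} (pointCharacter v) := by
  obtain ⟨ι, G, hG, hGbase, hcard⟩ := exists_family_mk_eq_pointCharacter_omegaStar v
  rw [← hcard]
  refine pointCharacter_corona_le _
    (fun i => {y | ∃ n ∈ G i, dist y (x n) ≤ ε}) (fun i => ?_) fun A hA => ?_
  · refine mem_asymptoticFilter_sharpMap_iff.2 ⟨G i, hG i, fun k => ⟨k, fun n hn hkn y hy => ?_⟩⟩
    refine ⟨n, hn, ?_⟩
    rw [← Metric.mem_closedBall, h n]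
    refine Metric.closedBall_subset_closedBall ?_ hy
    have : (k : ℝ) ≤ n := by exact_mod_cast hkn
    linarith
  · obtain ⟨s, hs, hsA⟩ := mem_asymptoticFilter_sharpMap_iff.1 hA
    obtain ⟨i, hi⟩ := hGbase s hs
    obtain ⟨M, hM⟩ := hi.bddAbove
    obtain ⟨m, hm⟩ := hsA ⌈ε⌉₊
    refine ⟨i, ((Bornology.isBounded_biUnion (Set.finite_Iio (max m (M + 1)))).2
      fun n _ => Metric.isBounded_closedBall (x := x n) (r := ε)).subset ?_⟩
    rintro y ⟨⟨n, hn, hy⟩, hyA⟩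
    refine Set.mem_biUnion (x := n) ?_ hy
    by_contra hmax
    rw [Set.mem_Iio, not_lt] at hmax
    have hns : n ∈ s := by
      by_contra hns
      have := hM ⟨hn, hns⟩
      omega
    exact hyA (hm n hns (le_of_max_le_left hmax) (le_trans hy (Nat.le_ceil ε)))

theorem exists_isolated_sequence (hX : ¬ Bornology.IsBounded (Set.univ : Set X)) (o : X) {ε : ℝ}
    (hε : 0 ≤ ε) (h : ∀ δ : ℝ, ε ≤ δ → ∃ x : X, Metric.closedBall x ε = Metric.closedBall x δ) (n : ℕ) :
    ∃ x : X, (n : ℝ) ≤ dist x o ∧ Metric.closedBall x ε = Metric.closedBall x (ε + n) := by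
  have hz : ∃ z, ε + n < dist z o := by
    by_contra! hcon
    exact hX ((Metric.isBounded_iff_subset_closedBall o).2 ⟨_, fun z _ => hcon z⟩)
  obtain ⟨z, hz⟩ := hz
  have hz0 : 0 ≤ dist z o := dist_nonneg
  -- The radius is large enough to reach `z` from any center within `n` of `o`; isolation would then
  -- put `z` in the `ε`-ball, contradicting its distance from `o`. Hence the center is far away.
  obtain ⟨x, hx⟩ := h (ε + n + dist z o) (by linarith [(Nat.cast_nonneg n : (0 : ℝ) ≤ n)])
  refine ⟨x, ?_, ?_⟩
  · by_contra! hlt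
    have h1 : z ∈ Metric.closedBall x (ε + n + dist z o) := by
      rw [Metric.mem_closedBall]
      linarith [dist_triangle_right z x o]
    rw [← hx, Metric.mem_closedBall] at h1
    linarith [dist_triangle z x o]
  · refine (Metric.closedBall_subset_closedBall (by simp)).antisymm ?_
    rw [hx]
    exact Metric.closedBall_subset_closedBall (by linarith)

end UpperBounds

theorem theorem1p2 (X : Type u) [MetricSpace X]
    (hX : ¬ Bornology.IsBounded (Set.univ : Set X)) :
    (HasAsymptoticallyIsolatedBalls X →
      minCharacter (Corona X) = Cardinal.lift.{u} cardinalU) ∧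
    (¬ HasAsymptoticallyIsolatedBalls X →
      minCharacter (Corona X) = Cardinal.lift.{u} (max cardinalU cardinalD)) := by
  have := corona_nonempty X hX
  have := omegaStar_nonempty
  obtain ⟨o⟩ : Nonempty X := by
    by_contra hne
    rw [not_nonempty_iff] at hne
    exact hX (by simp [Set.univ_eq_empty_iff.2 hne])
  obtain ⟨v, hv⟩ := exists_pointCharacter_eq_minCharacter OmegaStar
  obtain ⟨c, hc⟩ := exists_pointCharacter_eq_minCharacter (Corona X)
  obtain ⟨p, rfl⟩ := Quotient.exists_rep c
  have hU := lift_cardinalU_le_pointCharacter p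
  rw [hc] at hU
  refine ⟨fun ⟨ε, hε, h⟩ => hU.antisymm' ?_, fun h => ?_⟩
  · choose x hxn hx using exists_isolated_sequence hX o hε h
    refine (minCharacter_le _).trans ((pointCharacter_sharpMap_le (v := v) (hx := hxn) hx hε).trans ?_)
    rw [hv, cardinalU]
  · have hD := lift_cardinalD_le_pointCharacter h p
    rw [hc] at hD
    refine le_antisymm ?_ (by rw [Cardinal.lift_max]; exact max_le hU hD)
    have hfar : ∀ n : ℕ, ∃ x : X, (n : ℝ) ≤ dist x o := by
      intro n
      by_contra! hcon
      exact hX ((Metric.isBounded_iff_subset_closedBall o).2 ⟨n, fun z _ => (hcon z).le⟩)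
    choose x hx using hfar
    refine (minCharacter_le _).trans ((pointCharacter_sharpMap_le_max (v := v) (hx := hx)).trans ?_)
    rw [hv, cardinalU]
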